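/- Let $V$ be a finite dimensional real vector space with a positive definite inner product $\langle\cdot,\cdot\rangle$ and euclidean norm $\|v\|_2=\sqrt{\langle v,v\rangle}$, let $\|\cdot\|_X$ be a norm on $V$, and let $\|v\|_Y=\max\{\langle v,w\rangle\mid \|w\|_X=1\}$ be its dual norm (with $\|0\|_Y=0$ if $V=\{0\}$). For two norms $\|\cdot\|_N,\|\cdot\|_M$ on $V$ and $c\in V$, a pair $(x,y)\in\mathbb{R}^2$ is called Pareto efficient if there is a decomposition $c=a+b$ with $\|a\|_N=x$, $\|b\|_M=y$ such that for every decomposition $c=a'+b'$ we have $\|a'\|_N>x$, or $\|b'\|_M>y$, or $(\|a'\|_N,\|b'\|_M)=(x,y)$. A decomposition $c=a+b$ for which $(\|a\|_N,\|b\|_M)$ is Pareto efficient is called an $NM$-decomposition. The Pareto frontier of $c$ is the set of all Pareto efficient pairs for the norms $\|\cdot\|_X,\|\cdot\|_Y$. The Pareto sub-frontier of $c$ is the set of all pairs $(\|a\|_X,\|b\|_Y)$ where $c=a+b$ is an $X2$-decomposition. The vector $c$ is called tight if every $X2$-decomposition of $c$ is an $XY$-decomposition. The slope of a nonzero vector $v$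 is $\mu_{XY}(v)=\|v\|_Y/\|v\|_X$. An expression $c=c_1+\cdots+c_r$ with $r\geq 0$ (the empty sum being $0$) is called an $XY$-slope decomposition of $c$ if $c_1,\dots,c_r$ are nonzero, $\langle c_i,c_j\rangle=\|c_i\|_X\|c_j\|_Y$ for all $i\leq j$, and $\mu_{XY}(c_1)>\mu_{XY}(c_2)>\cdots>\mu_{XY}(c_r)$. **Theorem.** Let $c\in V$. 1. The vector $c$ is tight if and only if its Pareto frontier and its Pareto sub-frontier coincide, and $c$ is tight if and only if it has an $XY$-slope decomposition. 2. Suppose that $c=c_1+c_2+\cdots+c_r$ is an $XY$-slope decomposition, and let $x_i=\|c_i\|_X$ and $y_i=\|c_i\|_Y$ for all $i$. Then $\|c\|_X=\sum_{i=1}^r x_i$, $\|c\|_Y=\sum_{i=1}^r y_i$, and the Pareto frontier of $c$, which is the same as the Pareto sub-frontier of $c$, is the piecewise linear curve through the points $$(x_1+\cdots+x_i,\;y_{i+1}+\cdots+y_r),\qquad i=0,1,2,\dots,r,$$ that is, the union of the line segments joining consecutive points (the single point $(0,0)$ if $r=0$). -/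

import Mathlib

namespace ParetoSlope

section Pareto

variable {V : Type*} [AddCommGroup V]

/-- The pair `p = (x, y)` is Pareto efficient for `c` and the functions `N`, `M` (norms, in that
order): it is realised by a decomposition `c = a + b` with `N a = x` and `M b = y`, and every
decomposition `c = a' + b'` has `N a' > x`, or `M b' > y`, or `(N a', M b') = (x, y)`. -/
def IsParetoEfficient (N M : V → ℝ) (c : V) (p : ℝ × ℝ) : Prop :=
  ∃ a b : V, c = a + b ∧ N a = p.1 ∧ M b = p.2 ∧
    ∀ a' b' : V, c = a' + b' → N a' > p.1 ∨ M b' > p.2 ∨ (N a', M b') = p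

/-- `c = a + b` is an `NM`-decomposition. -/
def IsDecomposition (N M : V → ℝ) (c a b : V) : Prop :=
  c = a + b ∧ IsParetoEfficient N M c (N a, M b)

/-- The Pareto frontier of `c`: the set of all Pareto efficient pairs. -/
def paretoFrontier (N M : V → ℝ) (c : V) : Set (ℝ × ℝ) :=
  {p | IsParetoEfficient N M c p}

end Pareto

section Dual

variable {V : Type*} [NormedAddCommGroup V] [InnerProductSpace ℝ V]

/-- The dual norm `‖v‖_Y = max {⟨v, w⟩ | ‖w‖_X = 1}` of the norm `X`. On a finite dimensional
space the supremum is attained; on the zero space the set is empty and the value is `0`. -/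
noncomputable def dualNorm (X : V → ℝ) (v : V) : ℝ :=
  sSup {t : ℝ | ∃ w : V, X w = 1 ∧ t = inner ℝ v w}

/-- The Pareto sub-frontier of `c`: all pairs `(‖a‖_X, ‖b‖_Y)` where `c = a + b` is an
`X2`-decomposition, `2` standing for the euclidean norm. -/
def paretoSubFrontier (X Y : V → ℝ) (c : V) : Set (ℝ × ℝ) :=
  {p | ∃ a b : V, IsDecomposition X (fun v => ‖v‖) c a b ∧ X a = p.1 ∧ Y b = p.2}

/-- `c` is tight: every `X2`-decomposition of `c` is an `XY`-decomposition. -/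
def IsTight (X Y : V → ℝ) (c : V) : Prop :=
  ∀ a b : V, IsDecomposition X (fun v => ‖v‖) c a b → IsDecomposition X Y c a b

/-- The slope `μ_XY(v) = ‖v‖_Y / ‖v‖_X` of a nonzero vector `v`. -/
noncomputable def slope (X Y : V → ℝ) (v : V) : ℝ := Y v / X v

/-- `c = d 0 + ⋯ + d (r - 1)` is an `XY`-slope decomposition. The empty sum (`r = 0`) is
allowed; it is the slope decomposition of `c = 0`. -/
structure IsSlopeDecomposition (X Y : V → ℝ) (c : V) {r : ℕ} (d : Fin r → V) : Prop where
  sum_eq : c = ∑ i, d i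
  ne_zero : ∀ i, d i ≠ 0
  inner_eq : ∀ i j, i ≤ j → inner ℝ (d i) (d j) = X (d i) * Y (d j)
  slope_strictAnti : ∀ i j, i < j → slope X Y (d i) > slope X Y (d j)

end Dual

/-- The point `(x_1 + ⋯ + x_k, y_{k+1} + ⋯ + y_r)`, for `k = 0, 1, …, r`. The terms are indexed
by `Fin r`, so that the first `k` terms are those of index less than `k`. -/
def breakpoint {r : ℕ} (x y : Fin r → ℝ) (k : Fin (r + 1)) : ℝ × ℝ :=
  (∑ i with i.castSucc < k, x i, ∑ i with k ≤ i.castSucc, y i)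

/-- The piecewise linear curve through the points `P 0, P 1, …, P r`, in this order: the union of
the segments between consecutive points (and the points themselves, which matters only if
`r = 0`). -/
def polygonalCurve {r : ℕ} (P : Fin (r + 1) → ℝ × ℝ) : Set (ℝ × ℝ) :=
  Set.range P ∪ ⋃ k : Fin r, segment ℝ (P k.castSucc) (P k.succ)

end ParetoSlope

/-!
Write `Y` for the dual norm of `X`. A decomposition `c = a + b` is efficient for `X` and the
euclidean norm exactly if it attains equality in the duality inequality `⟨a, b⟩ ≤ ‖a‖_X ‖b‖_Y`
(`isDecomposition_iff`): `a` is then the euclidean projection of `c` to an `X`-ball. For every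
`x` between `0` and `‖c‖_X` there is exactly one such decomposition with `‖a‖_X = x`. Hence both
frontiers are graphs over `[0, ‖c‖_X]`, and tightness means that the graphs agree.

Given a slope decomposition, split `c` inside its `k`-th summand `c_k`. Pairing the two parts with
`c_k` computes their norms, and pairing any other decomposition of `c` with `c_k` shows that the
pair of norms is efficient for `X` and `Y` (`IsSlopeDecomposition.split`). These pairs fill the
polygonal curve, so by uniqueness every euclidean decomposition arises in this way.

Conversely let `c` be tight, let `α x` be the first part of the euclidean decomposition with
`‖α x‖_X = x`, and put `f x = ‖c - α x‖_Y`. Efficiency of `(x, f x)` for `X` and `Y` gives, by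
separation of convex sets, a certificate `w x` in the unit ball of `X` with
`⟨w x, c - α x⟩ = f x` and `⟨α x, w x⟩ = x ‖w x‖_Y` (`exists_certificate`); with `m x = ‖w x‖_Y`,
the line of slope `-m x` supports `f` at `x`. Expanding the square gives
`‖α y - α x - (y - x) w x‖² ≤ (y - x)² (m x - m y)`. As `m` is monotone, a bisection argument
shows that `X` and `Y` are additive along the path `α` (`IsCertifiedPath.seminorm_sub_eq`,
`IsCertifiedPath.dualNorm_sub_eq`), and therefore that increments of `α` over consecutive
intervals satisfy `⟨u, v⟩ = ‖u‖_X ‖v‖_Y`. The span of all `s α t - t α s` with `s, t ≤ z` is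
orthogonal to `w z` and increases with `z`; where its dimension is constant, `f` is affine
(`IsCertifiedPath.dualNorm_sub_eq_of_finrank_eq`). So `f` has finitely many segments, and the
increments of `α` over the maximal segments form a slope decomposition.
-/

namespace ParetoSlope

open scoped InnerProductSpace
open Set

/-! ### Efficient pairs -/

/-- The first coordinate of an efficient pair is at most `N e`, as `e = e + 0` competes. -/
theorem IsParetoEfficient.fst_le {E : Type*} [AddCommGroup E] {N M : E → ℝ} {e : E}
    {p : ℝ × ℝ} (h : IsParetoEfficient N M e p)
    (hM : ∀ v, M 0 ≤ M v) : p.1 ≤ N e := by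
  obtain ⟨a, b, hc, ha, hb, h⟩ := h
  by_contra! hlt
  rcases h e 0 (add_zero e).symm with h | h | h
  · exact lt_asymm h hlt
  · exact absurd (hM b) (by rw [hb]; exact h.not_ge)
  · rw [← h] at hlt
    exact lt_irrefl _ hlt

/-- Two efficient pairs with the same first coordinate agree. -/
theorem IsParetoEfficient.eq_of_fst_eq {E : Type*} [AddCommGroup E] {N M : E → ℝ} {e : E}
    {p q : ℝ × ℝ} (hp : IsParetoEfficient N M e p) (hq : IsParetoEfficient N M e q)
    (h : p.1 = q.1) : p = q := by
  obtain ⟨a, b, hc, ha, hb, hp⟩ := hp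
  obtain ⟨a', b', hc', ha', hb', hq⟩ := hq
  refine Prod.ext h (le_antisymm ?_ ?_)
  · rcases hp a' b' hc' with h1 | h1 | h1
    · exact absurd h1 (by rw [ha', h]; exact lt_irrefl _)
    · exact hb' ▸ h1.le
    · rw [← h1]; exact hb'.le
  · rcases hq a b hc with h1 | h1 | h1
    · exact absurd h1 (by rw [ha, h]; exact lt_irrefl _)
    · exact hb ▸ h1.le
    · rw [← h1]; exact hb.le

/-! ### The dual norm -/

variable {V : Type*} [NormedAddCommGroup V] [InnerProductSpace ℝ V]
  {X : Seminorm ℝ V} {c : V}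

theorem pos_of_ne_zero (hX : ∀ v : V, X v = 0 → v = 0) {v : V} (hv : v ≠ 0) : 0 < X v :=
  lt_of_le_of_ne (apply_nonneg X v) fun h => hv (hX v h.symm)

theorem dualNorm_le {v : V} {s : ℝ} (hs : 0 ≤ s) (h : ∀ w, ⟪w, v⟫_ℝ ≤ s * X w) :
    dualNorm X v ≤ s := by
  refine Real.sSup_le ?_ hs
  rintro _ ⟨w, hw, rfl⟩
  simpa [hw, real_inner_comm] using h w

theorem dualNorm_zero : dualNorm X (0 : V) = 0 := by
  refine le_antisymm (dualNorm_le le_rfl (by simp)) (Real.sSup_nonneg ?_)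
  rintro _ ⟨w, -, rfl⟩
  simp

theorem seminorm_smul_of_nonneg (X : Seminorm ℝ V) {t : ℝ} (ht : 0 ≤ t) (v : V) :
    X (t • v) = t * X v := by
  rw [map_smul_eq_mul, Real.norm_of_nonneg ht]

theorem seminorm_sum_le (X : Seminorm ℝ V) {ι : Type*} (s : Finset ι) (d : ι → V) :
    X (∑ i ∈ s, d i) ≤ ∑ i ∈ s, X (d i) :=
  Finset.le_sum_of_subadditive _ (map_zero X).le (map_add_le_add X) s d

/-! ### Breakpoints and slope decompositions -/

theorem breakpoint_castSucc {r : ℕ} (x y : Fin r → ℝ) (k : Fin r) :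
    breakpoint x y k.castSucc = (∑ i with i < k, x i, y k + ∑ i with k < i, y i) := by
  have : (Finset.univ.filter fun i => k ≤ i) = insert k (Finset.univ.filter fun i => k < i) := by
    ext i
    simp [le_iff_eq_or_lt, eq_comm]
  simp only [breakpoint, Fin.castSucc_lt_castSucc_iff, Fin.castSucc_le_castSucc_iff]
  rw [this, Finset.sum_insert (by simp)]

theorem breakpoint_succ {r : ℕ} (x y : Fin r → ℝ) (k : Fin r) :
    breakpoint x y k.succ = (∑ i with i < k, x i + x k, ∑ i with k < i, y i) := by
  have : (Finset.univ.filter fun i => i ≤ k) = insert k (Finset.univ.filter fun i => i < k) := by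
    ext i
    simp [le_iff_eq_or_lt]
  simp only [breakpoint, ← Fin.le_castSucc_iff, Fin.succ_le_castSucc_iff,
    Fin.castSucc_le_castSucc_iff]
  rw [this, Finset.sum_insert (by simp), add_comm]

theorem breakpoint_zero {r : ℕ} (x y : Fin r → ℝ) : breakpoint x y 0 = (0, ∑ i, y i) := by
  simp [breakpoint]

theorem breakpoint_last {r : ℕ} (x y : Fin r → ℝ) :
    breakpoint x y (Fin.last r) = (∑ i, x i, 0) := by
  simp [breakpoint, Fin.castSucc_lt_last, Fin.last_le_iff, Fin.castSucc_ne_last]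

/-- A discrete intermediate value theorem. -/
theorem exists_castSucc_le_le_succ {r : ℕ} (hr : 0 < r) (S : Fin (r + 1) → ℝ) {x : ℝ}
    (h0 : S 0 ≤ x) (h1 : x ≤ S (Fin.last r)) : ∃ k : Fin r, S k.castSucc ≤ x ∧ x ≤ S k.succ := by
  by_contra! h
  have : ∀ k : Fin (r + 1), S k ≤ x ∧ (k ≠ 0 → S k < x) := by
    intro k
    induction k using Fin.induction with
    | zero => exact ⟨h0, fun h => absurd rfl h⟩
    | succ k ih => exact ⟨(h k ih.1).le, fun _ => h k ih.1⟩
  exact absurd h1 (not_le.2 ((this (Fin.last r)).2 (by simp [Fin.ext_iff]; omega)))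

theorem IsSlopeDecomposition.eq_sum {r : ℕ} {d : Fin r → V}
    (h : IsSlopeDecomposition X (dualNorm X) c d) (k : Fin r) :
    c = ∑ i with i < k, d i + d k + ∑ i with k < i, d i := by
  have h1 : (Finset.univ : Finset (Fin r)) =
      (insert k (Finset.univ.filter fun i => i < k)) ∪ Finset.univ.filter fun i => k < i := by
    ext i
    rcases lt_trichotomy i k with h | h | h <;> simp [h]
  have h2 : ∑ i, d i = _ := congrArg (fun s => ∑ i ∈ s, d i) h1
  rw [h.sum_eq, h2, Finset.sum_union, Finset.sum_insert (by simp), add_comm (d k)]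
  rw [Finset.disjoint_left]
  intro i hi hi'
  simp only [Finset.mem_insert, Finset.mem_filter, Finset.mem_univ, true_and] at hi hi'
  rcases hi with rfl | hi
  · exact lt_irrefl _ hi'
  · exact lt_asymm hi hi'

theorem IsSlopeDecomposition.cons {X Y : V → ℝ} {r : ℕ} {d : Fin r → V}
    (h : IsSlopeDecomposition X Y c d) {v : V} (hv : v ≠ 0) (hvv : ⟪v, v⟫_ℝ = X v * Y v)
    (hvd : ∀ i, ⟪v, d i⟫_ℝ = X v * Y (d i)) (hslope : ∀ i, slope X Y (d i) < slope X Y v) :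
    IsSlopeDecomposition X Y (v + c) (Fin.cons v d : Fin (r + 1) → V) where
  sum_eq := by rw [Fin.sum_univ_succ, h.sum_eq]; simp
  ne_zero i := by
    cases i using Fin.cases with
    | zero => exact hv
    | succ i => exact h.ne_zero i
  inner_eq i j hij := by
    cases i using Fin.cases with
    | zero =>
      cases j using Fin.cases with
      | zero => exact hvv
      | succ j => exact hvd j
    | succ i =>
      cases j using Fin.cases with
      | zero => exact absurd hij (not_le.2 (Fin.succ_pos i))
      | succ j => exact h.inner_eq i j (Fin.succ_le_succ_iff.1 hij)
  slope_strictAnti i j hij := by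
    cases j using Fin.cases with
    | zero => exact absurd hij (Fin.not_lt_zero i)
    | succ j =>
      cases i using Fin.cases with
      | zero => exact hslope j
      | succ i => exact h.slope_strictAnti i j (Fin.succ_lt_succ_iff.1 hij)

/-! ### The span of the turns of a path -/

/-- The span of the differences of the quotients `α t / t` on `[0, z]`, with denominators cleared.
It grows with `z`, and for a certified path it must grow at every turn. -/
def turnSpan (α : ℝ → V) (z : ℝ) : Submodule ℝ V :=
  Submodule.span ℝ {v | ∃ s ∈ Icc 0 z, ∃ t ∈ Icc 0 z, v = s • α t - t • α s}

theorem turnSpan_mono (α : ℝ → V) : Monotone (turnSpan α) := by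
  intro y z hyz
  refine Submodule.span_mono ?_
  rintro _ ⟨s, hs, t, ht, rfl⟩
  exact ⟨s, ⟨hs.1, hs.2.trans hyz⟩, t, ⟨ht.1, ht.2.trans hyz⟩, rfl⟩

/-! ### The dual norm on a finite dimensional space -/

variable [FiniteDimensional ℝ V]

theorem continuous_seminorm (X : Seminorm ℝ V) : Continuous X :=
  (ConvexOn.locallyLipschitz X.convexOn).continuous

theorem exists_norm_le_mul (hX : ∀ v : V, X v = 0 → v = 0) : ∃ C, 0 < C ∧ ∀ v, ‖v‖ ≤ C * X v := by
  rcases subsingleton_or_nontrivial V with h | h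
  · exact ⟨1, one_pos, fun v => by simp [Subsingleton.elim v 0]⟩
  obtain ⟨u, hu, hmin⟩ := (isCompact_sphere (0 : V) 1).exists_isMinOn
    (NormedSpace.sphere_nonempty.2 zero_le_one) (continuous_seminorm X).continuousOn
  have hu1 : ‖u‖ = 1 := by simpa using hu
  have hpos : 0 < X u := by
    refine lt_of_le_of_ne (apply_nonneg X u) fun h0 => ?_
    rw [hX u h0.symm] at hu1
    simp at hu1
  refine ⟨(X u)⁻¹, inv_pos.2 hpos, fun v => ?_⟩
  rcases eq_or_ne v 0 with rfl | hv
  · simp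
  have hv' : 0 < ‖v‖ := norm_pos_iff.2 hv
  have h1 : X u ≤ X (‖v‖⁻¹ • v) := hmin (by simp [norm_smul, hv'.ne'])
  rw [map_smul_eq_mul, norm_inv, norm_norm, inv_mul_eq_div, le_div_iff₀ hv'] at h1
  rw [inv_mul_eq_div, le_div_iff₀ hpos]
  linarith

theorem dualNorm_bddAbove (hX : ∀ v : V, X v = 0 → v = 0) (v : V) :
    BddAbove {t : ℝ | ∃ w : V, X w = 1 ∧ t = ⟪v, w⟫_ℝ} := by
  obtain ⟨C, -, h⟩ := exists_norm_le_mul hX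
  refine ⟨‖v‖ * C, ?_⟩
  rintro _ ⟨w, hw, rfl⟩
  have := h w
  rw [hw, mul_one] at this
  exact (real_inner_le_norm v w).trans (by gcongr)

/-- The duality inequality `⟨w, v⟩ ≤ ‖w‖_X ‖v‖_Y`. -/
theorem inner_le_mul_dualNorm (hX : ∀ v : V, X v = 0 → v = 0) (w v : V) :
    ⟪w, v⟫_ℝ ≤ X w * dualNorm X v := by
  rcases eq_or_ne w 0 with rfl | hw
  · simp
  have hpos := pos_of_ne_zero hX hw
  have h := le_csSup (dualNorm_bddAbove hX v) ⟨(X w)⁻¹ • w, by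
    simp [map_smul_eq_mul, abs_of_pos hpos, hpos.ne'], rfl⟩
  rw [inner_smul_right, inv_mul_eq_div, div_le_iff₀ hpos, real_inner_comm] at h
  rw [mul_comm]
  exact h

theorem dualNorm_nonneg (hX : ∀ v : V, X v = 0 → v = 0) (v : V) : 0 ≤ dualNorm X v := by
  rcases eq_or_ne v 0 with rfl | hv
  · exact dualNorm_zero.ge
  by_contra! h
  have h1 := inner_le_mul_dualNorm hX v v
  rw [real_inner_self_eq_norm_sq] at h1
  have := mul_pos_of_neg_of_neg h (neg_lt_zero.2 (pos_of_ne_zero hX hv))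
  nlinarith [sq_nonneg ‖v‖]

theorem dualNorm_pos (hX : ∀ v : V, X v = 0 → v = 0) {v : V} (hv : v ≠ 0) :
    0 < dualNorm X v := by
  have h1 := inner_le_mul_dualNorm hX v v
  rw [real_inner_self_eq_norm_sq] at h1
  have h2 : 0 < ‖v‖ ^ 2 := by positivity
  exact pos_of_mul_pos_right (h2.trans_le h1) (apply_nonneg X v)

theorem eq_zero_of_dualNorm_eq_zero (hX : ∀ v : V, X v = 0 → v = 0) {v : V}
    (hv : dualNorm X v = 0) : v = 0 := by
  by_contra h
  exact (dualNorm_pos hX h).ne' hv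

theorem dualNorm_add_le (hX : ∀ v : V, X v = 0 → v = 0) (u v : V) :
    dualNorm X (u + v) ≤ dualNorm X u + dualNorm X v := by
  refine dualNorm_le (add_nonneg (dualNorm_nonneg hX u) (dualNorm_nonneg hX v)) fun w => ?_
  rw [inner_add_right]
  linarith [inner_le_mul_dualNorm hX w u, inner_le_mul_dualNorm hX w v]

theorem dualNorm_smul_le (hX : ∀ v : V, X v = 0 → v = 0) {t : ℝ} (ht : 0 ≤ t) (v : V) :
    dualNorm X (t • v) ≤ t * dualNorm X v := by
  refine dualNorm_le (mul_nonneg ht (dualNorm_nonneg hX v)) fun w => ?_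
  rw [inner_smul_right]
  nlinarith [mul_le_mul_of_nonneg_left (inner_le_mul_dualNorm hX w v) ht]

theorem dualNorm_smul (hX : ∀ v : V, X v = 0 → v = 0) {t : ℝ} (ht : 0 < t) (v : V) :
    dualNorm X (t • v) = t * dualNorm X v := by
  refine le_antisymm (dualNorm_smul_le hX ht.le v) ?_
  have := dualNorm_smul_le hX (inv_pos.2 ht).le (t • v)
  rw [smul_smul, inv_mul_cancel₀ ht.ne', one_smul, inv_mul_eq_div, le_div_iff₀ ht] at this
  linarith

theorem dualNorm_sum_le (hX : ∀ v : V, X v = 0 → v = 0) {ι : Type*} (s : Finset ι) (d : ι → V) :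
    dualNorm X (∑ i ∈ s, d i) ≤ ∑ i ∈ s, dualNorm X (d i) :=
  Finset.le_sum_of_subadditive _ dualNorm_zero.le (dualNorm_add_le hX) s d

/-- A constant bounding both norms by the euclidean norm. -/
theorem exists_bounds (hX : ∀ v : V, X v = 0 → v = 0) :
    ∃ C, 0 < C ∧ (∀ v, X v ≤ C * ‖v‖) ∧ ∀ v, dualNorm X v ≤ C * ‖v‖ := by
  obtain ⟨K, hK, h1⟩ := exists_norm_le_mul hX
  obtain ⟨L, hL, h2⟩ := Seminorm.bound_of_continuous_normedSpace X (continuous_seminorm X)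
  refine ⟨L + K, by positivity, fun v => (h2 v).trans ?_, fun v => ?_⟩
  · exact mul_le_mul_of_nonneg_right (by linarith) (norm_nonneg v)
  · refine dualNorm_le (by positivity) fun w => (real_inner_le_norm w v).trans ?_
    refine (mul_le_mul_of_nonneg_right (h1 w) (norm_nonneg v)).trans ?_
    nlinarith [mul_nonneg (mul_nonneg hL.le (norm_nonneg v)) (apply_nonneg X w)]

theorem continuous_dualNorm (hX : ∀ v : V, X v = 0 → v = 0) : Continuous (dualNorm X) := by
  refine (ConvexOn.locallyLipschitz (f := dualNorm X)
    ⟨convex_univ, fun u _ v _ a b ha hb _ => ?_⟩).continuous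
  exact (dualNorm_add_le hX _ _).trans
    (add_le_add (dualNorm_smul_le hX ha u) (dualNorm_smul_le hX hb v))

/-- Every vector is normed by some `v` in the duality inequality: `X` is the dual norm of its dual
norm. -/
theorem exists_inner_eq_mul (hX : ∀ v : V, X v = 0 → v = 0) {w : V} (hw : w ≠ 0) :
    ∃ v : V, v ≠ 0 ∧ ⟪w, v⟫_ℝ = X w * dualNorm X v := by
  have hpos := pos_of_ne_zero hX hw
  obtain ⟨φ, hφ⟩ := geometric_hahn_banach_open_point (s := {u | X u < X w})
    (by simpa using X.convexOn.convex_lt (X w))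
    (isOpen_lt (continuous_seminorm X) continuous_const) (x := w) (by simp)
  set v := (InnerProductSpace.toDual ℝ V).symm φ with hv
  have hφv : ∀ u, φ u = ⟪u, v⟫_ℝ := fun u => by
    rw [real_inner_comm, hv, InnerProductSpace.toDual_symm_apply]
  have hwv : 0 < ⟪w, v⟫_ℝ := by
    have := hφ 0 (by simpa using hpos)
    rwa [map_zero, hφv] at this
  refine ⟨v, fun h => by simp [h] at hwv, le_antisymm (inner_le_mul_dualNorm hX w v) ?_⟩
  rw [mul_comm, ← le_div_iff₀ hpos]
  refine dualNorm_le (by positivity) fun u => ?_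
  rw [div_mul_eq_mul_div, le_div_iff₀ hpos]
  by_contra! h
  rcases eq_or_ne u 0 with rfl | hu
  · simp at h
  have hu' := pos_of_ne_zero hX hu
  -- Rescale `u` so that it pairs to `⟨w, v⟩`; it then lies strictly inside the ball.
  have huv : 0 < ⟪u, v⟫_ℝ := pos_of_mul_pos_left (lt_trans (by positivity) h) hpos.le
  have := hφ ((⟪w, v⟫_ℝ / ⟪u, v⟫_ℝ) • u) (by
    rw [mem_ofPred_eq, seminorm_smul_of_nonneg X (by positivity), div_mul_eq_mul_div,
      div_lt_iff₀ huv]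
    linarith)
  rw [hφv, hφv, inner_smul_left] at this
  simp [huv.ne'] at this

/-! ### Euclidean decompositions -/

/-- If `⟨a, b⟩ = ‖a‖_X ‖b‖_Y`, then `a` is the strict euclidean minimiser of the distance to
`a + b` on the `X`-ball of radius `‖a‖_X`. -/
theorem norm_sq_add_norm_sq_le (hX : ∀ v : V, X v = 0 → v = 0) {a b a' b' : V}
    (hab : ⟪a, b⟫_ℝ = X a * dualNorm X b) (h : a + b = a' + b') (ha : X a' ≤ X a) :
    ‖b‖ ^ 2 + ‖a - a'‖ ^ 2 ≤ ‖b'‖ ^ 2 := by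
  have hb' : b' = b + (a - a') := by
    rw [eq_sub_of_add_eq' h.symm]
    abel
  rw [hb', norm_add_sq_real, inner_sub_right, real_inner_comm, hab, real_inner_comm]
  have h1 := inner_le_mul_dualNorm hX a' b
  have h2 := mul_le_mul_of_nonneg_right ha (dualNorm_nonneg hX b)
  linarith

theorem isDecomposition_of_inner_eq (hX : ∀ v : V, X v = 0 → v = 0) {a b : V} (hc : c = a + b)
    (hab : ⟪a, b⟫_ℝ = X a * dualNorm X b) : IsDecomposition X (fun v => ‖v‖) c a b := by
  refine ⟨hc, a, b, hc, rfl, rfl, fun a' b' hc' => ?_⟩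
  by_contra! h
  obtain ⟨h1, h2, h3⟩ := h
  have h4 := norm_sq_add_norm_sq_le hX hab (hc.symm.trans hc') h1
  have h5 : ‖b'‖ ^ 2 ≤ ‖b‖ ^ 2 := by gcongr
  have h6 : a = a' := by
    rw [← sub_eq_zero, ← norm_eq_zero]
    exact pow_eq_zero_iff two_ne_zero |>.1 (le_antisymm (by linarith) (sq_nonneg _))
  subst h6
  have h7 : b = b' := add_left_cancel (hc.symm.trans hc')
  subst h7
  exact h3 rfl

/-- Every radius between `0` and `‖c‖_X` occurs in a decomposition with `⟨a, b⟩ = ‖a‖_X ‖b‖_Y`: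
take for `a` the euclidean projection of `c` to the `X`-ball. -/
theorem exists_inner_eq_of_le (hX : ∀ v : V, X v = 0 → v = 0) {x : ℝ} (h0 : 0 ≤ x)
    (hx : x ≤ X c) : ∃ a : V, X a = x ∧ ⟪a, c - a⟫_ℝ = x * dualNorm X (c - a) := by
  have hconv : Convex ℝ {u | X u ≤ x} := by simpa using X.convexOn.convex_le x
  have hclosed : IsClosed {u | X u ≤ x} := isClosed_le (continuous_seminorm X) continuous_const
  obtain ⟨a, ha, hmin⟩ := exists_norm_eq_iInf_of_complete_convex ⟨0, by simpa using h0⟩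
    hclosed.isComplete hconv c
  rw [norm_eq_iInf_iff_real_inner_le_zero hconv ha] at hmin
  have ha : X a ≤ x := ha
  have hY := dualNorm_nonneg hX (c - a)
  have key : x * dualNorm X (c - a) ≤ ⟪a, c - a⟫_ℝ := by
    rcases eq_or_ne (c - a) 0 with h | h
    · simp [h, dualNorm_zero]
    rcases h0.eq_or_lt with rfl | hpos
    · have : a = 0 := hX a (le_antisymm ha (apply_nonneg X a))
      simp [this]
    rw [mul_comm, ← le_div_iff₀ hpos]
    have h00 : 0 ≤ ⟪a, c - a⟫_ℝ := by
      have := hmin 0 (by simpa using h0)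
      rw [zero_sub, inner_neg_right, real_inner_comm] at this
      linarith
    refine dualNorm_le (by positivity) fun w => ?_
    rcases eq_or_ne w 0 with rfl | hw
    · simp
    have hw' := pos_of_ne_zero hX hw
    have := hmin ((x / X w) • w) (by
      rw [mem_ofPred_eq, seminorm_smul_of_nonneg X (by positivity), div_mul_cancel₀ _ hw'.ne'])
    rw [inner_sub_right, inner_smul_right, real_inner_comm, real_inner_comm a, sub_nonpos,
      div_mul_eq_mul_div, div_le_iff₀ hw'] at this
    rw [div_mul_eq_mul_div, le_div_iff₀ hpos]
    linarith
  have h1 := inner_le_mul_dualNorm hX a (c - a)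
  have h2 : X a = x := by
    rcases hY.eq_or_lt with h | h
    · rw [← sub_eq_zero.1 (eq_zero_of_dualNorm_eq_zero hX h.symm)] at ha ⊢
      exact le_antisymm ha hx
    · exact le_antisymm ha (le_of_mul_le_mul_right (key.trans h1) h)
  exact ⟨a, h2, le_antisymm (h2 ▸ h1) key⟩

theorem eq_of_inner_eq (hX : ∀ v : V, X v = 0 → v = 0) {a b a' b' : V}
    (hab : ⟪a, b⟫_ℝ = X a * dualNorm X b) (hab' : ⟪a', b'⟫_ℝ = X a' * dualNorm X b')
    (h : a + b = a' + b') (ha : X a = X a') : a = a' := by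
  have h1 := norm_sq_add_norm_sq_le hX hab h ha.ge
  have h2 := norm_sq_add_norm_sq_le hX hab' h.symm ha.le
  rw [← sub_eq_zero, ← norm_eq_zero]
  rw [norm_sub_rev] at h2
  exact pow_eq_zero_iff two_ne_zero |>.1 (le_antisymm (by linarith) (sq_nonneg _))

/-- The decompositions that are efficient for `X` and the euclidean norm are exactly those with
equality in the duality inequality. -/
theorem isDecomposition_iff (hX : ∀ v : V, X v = 0 → v = 0) {a b : V} :
    IsDecomposition X (fun v => ‖v‖) c a b ↔ c = a + b ∧ ⟪a, b⟫_ℝ = X a * dualNorm X b := by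
  refine ⟨fun h => ⟨h.1, ?_⟩, fun h => isDecomposition_of_inner_eq hX h.1 h.2⟩
  obtain ⟨hc, h⟩ := h
  obtain ⟨a₀, ha₀, hi⟩ := exists_inner_eq_of_le hX (apply_nonneg X a) (h.fst_le (by simp))
  have hi' : ⟪a₀, c - a₀⟫_ℝ = X a₀ * dualNorm X (c - a₀) := by rw [ha₀, hi]
  obtain ⟨-, -, -, -, -, h⟩ := h
  have h1 := norm_sq_add_norm_sq_le hX hi' (by rw [add_sub_cancel, hc]) ha₀.ge
  have h2 : ‖b‖ ≤ ‖c - a₀‖ := by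
    rcases h a₀ (c - a₀) (by simp) with h | h | h
    · exact absurd ha₀ h.ne'
    · exact le_of_lt h
    · exact (congrArg Prod.snd h).ge
  have h3 : ‖b‖ ^ 2 ≤ ‖c - a₀‖ ^ 2 := by gcongr
  have h4 : a₀ = a := by
    rw [← sub_eq_zero, ← norm_eq_zero]
    exact pow_eq_zero_iff two_ne_zero |>.1 (le_antisymm (by linarith) (sq_nonneg _))
  rw [h4] at hi'
  rwa [hc, add_sub_cancel_left] at hi'

/-! ### Tight vectors and the two frontiers -/

theorem isTight_iff_forall (hX : ∀ v : V, X v = 0 → v = 0) :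
    IsTight X (dualNorm X) c ↔ ∀ a, ⟪a, c - a⟫_ℝ = X a * dualNorm X (c - a) →
      IsParetoEfficient X (dualNorm X) c (X a, dualNorm X (c - a)) := by
  refine ⟨fun h a ha => (h a (c - a) (isDecomposition_of_inner_eq hX (by simp) ha)).2,
    fun h a b hab => ?_⟩
  obtain ⟨hc, hi⟩ := (isDecomposition_iff hX).1 hab
  obtain rfl : b = c - a := by rw [hc, add_sub_cancel_left]
  exact ⟨hc, h a hi⟩

theorem paretoSubFrontier_eq (hX : ∀ v : V, X v = 0 → v = 0) :
    paretoSubFrontier X (dualNorm X) c = {p | ∃ a, ⟪a, c - a⟫_ℝ = X a * dualNorm X (c - a) ∧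
      X a = p.1 ∧ dualNorm X (c - a) = p.2} := by
  ext p
  constructor
  · rintro ⟨a, b, hab, h1, h2⟩
    obtain ⟨hc, hi⟩ := (isDecomposition_iff hX).1 hab
    obtain rfl : b = c - a := by rw [hc, add_sub_cancel_left]
    exact ⟨a, hi, h1, h2⟩
  · rintro ⟨a, hi, h1, h2⟩
    exact ⟨a, c - a, isDecomposition_of_inner_eq hX (by simp) hi, h1, h2⟩

theorem isTight_iff_frontier_eq (hX : ∀ v : V, X v = 0 → v = 0) :
    IsTight X (dualNorm X) c ↔
      paretoFrontier X (dualNorm X) c = paretoSubFrontier X (dualNorm X) c := by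
  rw [isTight_iff_forall hX, paretoSubFrontier_eq hX]
  constructor
  · intro h
    ext p
    constructor
    · intro hp
      have h0 : 0 ≤ p.1 := by
        obtain ⟨a, b, -, ha, -⟩ := hp
        exact ha ▸ apply_nonneg X a
      obtain ⟨a, ha, hi⟩ := exists_inner_eq_of_le hX h0
        (hp.fst_le fun v => dualNorm_zero.trans_le (dualNorm_nonneg hX v))
      rw [← ha] at hi
      have := hp.eq_of_fst_eq (h a hi) ha.symm
      exact ⟨a, hi, ha, by rw [this]⟩
    · rintro ⟨a, hi, h1, h2⟩
      have := h a hi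
      rwa [h1, h2] at this
  · intro h a hi
    exact h.ge ⟨a, hi, rfl, rfl⟩

/-- **Dual certificate of efficiency.** If `(‖a‖_X, ‖b‖_Y)` is efficient for `a + b`, there is a
vector of the `X`-unit ball that attains equality in the duality inequality both with `b`, where
it is measured by `X`, and with `a`, where it is measured by the dual norm. -/
theorem exists_certificate (hX : ∀ v : V, X v = 0 → v = 0) {a b : V}
    (h : IsParetoEfficient X (dualNorm X) (a + b) (X a, dualNorm X b)) :
    ∃ w : V, X w ≤ 1 ∧ ⟪w, b⟫_ℝ = dualNorm X b ∧ ⟪a, w⟫_ℝ = X a * dualNorm X w := by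
  rcases eq_or_ne b 0 with rfl | hb
  · exact ⟨0, by simp, by simp [dualNorm_zero], by simp [dualNorm_zero]⟩
  have hbpos := dualNorm_pos hX hb
  obtain ⟨-, -, -, -, -, h⟩ := h
  have hYconv : ConvexOn ℝ univ (dualNorm X) := ⟨convex_univ, fun u _ v _ s t hs ht _ =>
    (dualNorm_add_le hX _ _).trans (add_le_add (dualNorm_smul_le hX hs u)
      (dualNorm_smul_le hX ht v))⟩
  -- Separate the open dual ball of radius `‖b‖_Y` from the set of all `a + b - a'` with
  -- `‖a'‖_X ≤ ‖a‖_X`; they are disjoint by efficiency.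
  obtain ⟨φ, u, h1, h2⟩ := geometric_hahn_banach_open (s := {v | dualNorm X v < dualNorm X b})
    (t := (fun a' => a + b - a') '' {a' | X a' ≤ X a})
    (by simpa using hYconv.convex_lt (dualNorm X b))
    (isOpen_lt (continuous_dualNorm hX) continuous_const)
    (by
      have : Convex ℝ {a' | X a' ≤ X a} := by simpa using X.convexOn.convex_le (X a)
      intro p hp q hq s t hs ht hst
      obtain ⟨p, hp, rfl⟩ := hp
      obtain ⟨q, hq, rfl⟩ := hq
      refine ⟨s • p + t • q, this hp hq hs ht hst, ?_⟩
      dsimp only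
      conv_lhs => rw [← one_smul ℝ (a + b), ← hst, add_smul]
      rw [smul_sub, smul_sub]
      abel)
    (by
      rw [disjoint_left]
      rintro _ hv ⟨a', ha', rfl⟩
      rcases h a' (a + b - a') (by simp) with h | h | h
      · exact absurd ha' (not_le.2 h)
      · exact lt_asymm h hv
      · exact hv.ne (congrArg Prod.snd h))
  set w := (InnerProductSpace.toDual ℝ V).symm φ with hw
  have hφw : ∀ v, φ v = ⟪v, w⟫_ℝ := fun v => by
    rw [real_inner_comm, hw, InnerProductSpace.toDual_symm_apply]
  simp only [hφw] at h1 h2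
  have hupos : 0 < u := by simpa using h1 0 (by simpa [dualNorm_zero] using hbpos)
  have hw0 : w ≠ 0 := by
    rintro h0
    have := h2 b ⟨a, le_refl (X a), by simp⟩
    rw [h0, inner_zero_right] at this
    linarith
  have hwpos := pos_of_ne_zero hX hw0
  have hu : X w * dualNorm X b ≤ u := by
    obtain ⟨v, hv0, hv⟩ := exists_inner_eq_mul hX hw0
    have hvpos := dualNorm_pos hX hv0
    refine le_of_forall_lt fun s hs => ?_
    rcases le_or_gt s 0 with h0 | h0
    · linarith
    have h3 : 0 < s / (X w * dualNorm X v) := by positivity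
    have := h1 ((s / (X w * dualNorm X v)) • v) (by
      rw [mem_ofPred_eq, dualNorm_smul hX h3, div_mul_eq_mul_div, div_lt_iff₀ (by positivity)]
      nlinarith)
    rw [inner_smul_left, real_inner_comm, hv] at this
    simpa [hwpos.ne', hvpos.ne'] using this
  have hK : ∀ a', X a' ≤ X a → X w * dualNorm X b + ⟪a', w⟫_ℝ ≤ ⟪a, w⟫_ℝ + ⟪b, w⟫_ℝ := by
    intro a' ha'
    have := h2 _ ⟨a', ha', rfl⟩
    rw [inner_sub_left, inner_add_left] at this
    linarith
  have e1 : ⟪w, b⟫_ℝ ≤ X w * dualNorm X b := inner_le_mul_dualNorm hX w b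
  have e2 : ⟪w, b⟫_ℝ = X w * dualNorm X b := by
    have := hK a le_rfl
    rw [real_inner_comm] at e1 ⊢
    linarith
  have e3 : X a * dualNorm X w ≤ ⟪a, w⟫_ℝ := by
    rcases eq_or_ne a 0 with rfl | ha
    · simp
    have hapos := pos_of_ne_zero hX ha
    have e4 : ∀ a', X a' ≤ X a → ⟪a', w⟫_ℝ ≤ ⟪a, w⟫_ℝ := by
      intro a' ha'
      have := hK a' ha'
      rw [real_inner_comm] at e2
      linarith
    rw [mul_comm, ← le_div_iff₀ hapos]
    refine dualNorm_le (div_nonneg (by simpa using e4 0 (by simp [hapos.le])) hapos.le) fun v => ?_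
    rcases eq_or_ne v 0 with rfl | hv
    · simp
    have hvpos := pos_of_ne_zero hX hv
    have := e4 ((X a / X v) • v) (by
      rw [seminorm_smul_of_nonneg X (by positivity), div_mul_cancel₀ _ hvpos.ne'])
    rw [inner_smul_left, RCLike.conj_to_real, div_mul_eq_mul_div, div_le_iff₀ hvpos] at this
    rw [div_mul_eq_mul_div, le_div_iff₀ hapos]
    linarith
  have e5 : ⟪a, w⟫_ℝ = X a * dualNorm X w := le_antisymm (inner_le_mul_dualNorm hX a w) e3
  refine ⟨(X w)⁻¹ • w, ?_, ?_, ?_⟩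
  · rw [seminorm_smul_of_nonneg X (by positivity), inv_mul_cancel₀ hwpos.ne']
  · rw [inner_smul_left, e2]
    simp [hwpos.ne']
  · rw [inner_smul_right, e5, dualNorm_smul hX (by positivity)]
    ring

section

variable {r : ℕ} {d : Fin r → V}

/-! ### From slope decompositions to the frontier -/

/-- The key computation: splitting `c` inside the `k`-th summand gives a decomposition that is
efficient both for `X` and the euclidean norm and for `X` and its dual. All estimates come from
pairing with `d k`. -/
theorem IsSlopeDecomposition.split (hX : ∀ v : V, X v = 0 → v = 0)
    (h : IsSlopeDecomposition X (dualNorm X) c d) (k : Fin r) {s t : ℝ} (hs : 0 ≤ s) (ht : 0 ≤ t)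
    (hst : s + t = 1) {p : ℝ × ℝ} (hp1 : p.1 = ∑ i with i < k, X (d i) + t * X (d k))
    (hp2 : p.2 = s * dualNorm X (d k) + ∑ i with k < i, dualNorm X (d i)) :
    ∃ a, ⟪a, c - a⟫_ℝ = X a * dualNorm X (c - a) ∧ X a = p.1 ∧ dualNorm X (c - a) = p.2 ∧
      IsParetoEfficient X (dualNorm X) c p := by
  set A := ∑ i with i < k, d i with hA
  set B := ∑ i with k < i, d i with hB
  set S := ∑ i with i < k, X (d i) with hS
  set T := ∑ i with k < i, dualNorm X (d i) with hT
  have hxk := pos_of_ne_zero hX (h.ne_zero k)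
  have hyk := dualNorm_pos hX (h.ne_zero k)
  have hc : c = A + d k + B := h.eq_sum k
  have hkk := h.inner_eq k k le_rfl
  have hAk : ⟪A, d k⟫_ℝ = S * dualNorm X (d k) := by
    rw [hA, sum_inner, hS, Finset.sum_mul]
    exact Finset.sum_congr rfl fun i hi => h.inner_eq i k (by simpa using hi : i < k).le
  have hkB : ⟪d k, B⟫_ℝ = X (d k) * T := by
    rw [hB, inner_sum, hT, Finset.mul_sum]
    exact Finset.sum_congr rfl fun i hi => h.inner_eq k i (by simpa using hi : k < i).le
  have hAB : ⟪A, B⟫_ℝ = S * T := by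
    rw [hA, hB, sum_inner, hS, Finset.sum_mul]
    refine Finset.sum_congr rfl fun i hi => ?_
    rw [inner_sum, hT, Finset.mul_sum]
    exact Finset.sum_congr rfl fun j hj => h.inner_eq i j
      ((by simpa using hi : i < k).trans (by simpa using hj : k < j)).le
  have hb : c - (A + t • d k) = s • d k + B := by
    rw [hc, eq_sub_of_add_eq hst, sub_smul, one_smul]
    abel
  have hXa : X (A + t • d k) = p.1 := by
    apply le_antisymm
    · rw [hp1]
      refine (map_add_le_add X _ _).trans (add_le_add (seminorm_sum_le X _ _) ?_)
      rw [seminorm_smul_of_nonneg X ht]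
    · have := inner_le_mul_dualNorm hX (A + t • d k) (d k)
      rw [inner_add_left, inner_smul_left, hAk, hkk] at this
      refine le_of_mul_le_mul_right (le_trans (le_of_eq ?_) this) hyk
      rw [hp1, RCLike.conj_to_real]
      ring
  have hYb : dualNorm X (s • d k + B) = p.2 := by
    apply le_antisymm
    · rw [hp2]
      exact (dualNorm_add_le hX _ _).trans
        (add_le_add (dualNorm_smul_le hX hs _) (dualNorm_sum_le hX _ _))
    · have := inner_le_mul_dualNorm hX (d k) (s • d k + B)
      rw [inner_add_right, inner_smul_right, hkB, hkk] at this
      refine le_of_mul_le_mul_left (le_trans (le_of_eq ?_) this) hxk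
      rw [hp2]
      ring
  refine ⟨A + t • d k, ?_, hXa, by rw [hb, hYb], ?_⟩
  · rw [hb, hXa, hYb, inner_add_left, inner_add_right, inner_add_right, inner_smul_left,
      inner_smul_left, inner_smul_right, inner_smul_right, hAk, hkB, hAB, hkk, hp1, hp2,
      RCLike.conj_to_real]
    ring
  · refine ⟨A + t • d k, c - (A + t • d k), by simp, hXa, by rw [hb, hYb], fun a' b' hc' => ?_⟩
    by_contra! hcon
    obtain ⟨h1, h2, h3⟩ := hcon
    have e1 := inner_le_mul_dualNorm hX a' (d k)
    have e2 := inner_le_mul_dualNorm hX (d k) b'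
    have e3 : ⟪c, d k⟫_ℝ = ⟪a', d k⟫_ℝ + ⟪d k, b'⟫_ℝ := by
      rw [hc', inner_add_left, real_inner_comm b']
    rw [hc, inner_add_left, inner_add_left, real_inner_comm (d k) B, hAk, hkk, hkB] at e3
    have e4 := mul_le_mul_of_nonneg_right h1 hyk.le
    have e5 := mul_le_mul_of_nonneg_left h2 hxk.le
    have e6 : p.1 * dualNorm X (d k) + X (d k) * p.2 = S * dualNorm X (d k) +
        X (d k) * dualNorm X (d k) + X (d k) * T := by
      rw [hp1, hp2, eq_sub_of_add_eq hst]
      ring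
    refine h3 (Prod.ext ?_ ?_)
    · exact le_antisymm h1 (le_of_mul_le_mul_right (by linarith) hyk)
    · exact le_antisymm h2 (le_of_mul_le_mul_left (by linarith) hxk)

/-- Every point of the polygonal curve of a slope decomposition is efficient, and it is realised
by a euclidean decomposition. -/
theorem IsSlopeDecomposition.exists_of_mem (hX : ∀ v : V, X v = 0 → v = 0)
    (h : IsSlopeDecomposition X (dualNorm X) c d) {p : ℝ × ℝ}
    (hp : p ∈ polygonalCurve (breakpoint (fun i => X (d i)) fun i => dualNorm X (d i))) :
    ∃ a, ⟪a, c - a⟫_ℝ = X a * dualNorm X (c - a) ∧ X a = p.1 ∧ dualNorm X (c - a) = p.2 ∧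
      IsParetoEfficient X (dualNorm X) c p := by
  rcases hp with ⟨k, rfl⟩ | hp
  · rcases Fin.eq_castSucc_or_eq_last k with ⟨k, rfl⟩ | rfl
    · exact h.split hX k zero_le_one le_rfl (by simp) (by simp [breakpoint_castSucc])
        (by simp [breakpoint_castSucc])
    · rcases r with _ | r
      · have hc : c = 0 := by simpa using h.sum_eq
        subst hc
        rw [breakpoint_last]
        refine ⟨0, by simp, by simp, by simp [dualNorm_zero], 0, 0, by simp, by simp,
          by simp [dualNorm_zero], fun a b _ => ?_⟩
        by_contra! hcon
        obtain ⟨h1, h2, h3⟩ := hcon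
        exact h3 (Prod.ext (le_antisymm h1 (by simp))
          (le_antisymm h2 (dualNorm_nonneg hX b)))
      · rw [← Fin.succ_last]
        exact h.split hX (Fin.last r) le_rfl zero_le_one (by simp)
          (by rw [breakpoint_succ]; simp) (by rw [breakpoint_succ]; simp)
  · obtain ⟨k, hp⟩ := mem_iUnion.1 hp
    obtain ⟨s, t, hs, ht, hst, rfl⟩ := hp
    rw [breakpoint_castSucc, breakpoint_succ]
    refine h.split hX k hs ht hst ?_ ?_
    · simp only [Prod.smul_mk, Prod.mk_add_mk, smul_eq_mul]
      linear_combination (∑ i with i < k, X (d i)) * hst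
    · simp only [Prod.smul_mk, Prod.mk_add_mk, smul_eq_mul]
      linear_combination (∑ i with k < i, dualNorm X (d i)) * hst

theorem IsSlopeDecomposition.seminorm_eq (hX : ∀ v : V, X v = 0 → v = 0)
    (h : IsSlopeDecomposition X (dualNorm X) c d) : X c = ∑ i, X (d i) := by
  obtain ⟨a, -, h1, h2, -⟩ := h.exists_of_mem hX (Or.inl ⟨Fin.last r, rfl⟩)
  rw [breakpoint_last] at h1 h2
  rw [sub_eq_zero.1 (eq_zero_of_dualNorm_eq_zero hX h2), h1]

theorem IsSlopeDecomposition.dualNorm_eq (hX : ∀ v : V, X v = 0 → v = 0)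
    (h : IsSlopeDecomposition X (dualNorm X) c d) : dualNorm X c = ∑ i, dualNorm X (d i) := by
  obtain ⟨a, -, h1, h2, -⟩ := h.exists_of_mem hX (Or.inl ⟨0, rfl⟩)
  rw [breakpoint_zero] at h1 h2
  rw [hX a h1, sub_zero] at h2
  exact h2

theorem IsSlopeDecomposition.exists_mem_fst_eq (hX : ∀ v : V, X v = 0 → v = 0)
    (h : IsSlopeDecomposition X (dualNorm X) c d) {x : ℝ} (h0 : 0 ≤ x) (hx : x ≤ X c) :
    ∃ p ∈ polygonalCurve (breakpoint (fun i => X (d i)) fun i => dualNorm X (d i)), p.1 = x := by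
  set P := breakpoint (fun i => X (d i)) fun i => dualNorm X (d i) with hP
  have hx' : x ≤ (P (Fin.last r)).1 := by rwa [hP, breakpoint_last, ← h.seminorm_eq hX]
  have h0' : (P 0).1 ≤ x := by rwa [hP, breakpoint_zero]
  rcases r.eq_zero_or_pos with rfl | hr
  · exact ⟨P 0, Or.inl ⟨0, rfl⟩, le_antisymm h0' hx'⟩
  · obtain ⟨k, hk1, hk2⟩ := exists_castSucc_le_le_succ hr (fun k => (P k).1) h0' hx'
    have : x ∈ segment ℝ (P k.castSucc).1 (P k.succ).1 := by
      rw [segment_eq_Icc (hk1.trans hk2)]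
      exact ⟨hk1, hk2⟩
    obtain ⟨s, t, hs, ht, hst, rfl⟩ := this
    exact ⟨s • P k.castSucc + t • P k.succ,
      Or.inr (mem_iUnion.2 ⟨k, s, t, hs, ht, hst, rfl⟩), by simp⟩

/-- Every euclidean decomposition lies over a point of the curve, by uniqueness. -/
theorem IsSlopeDecomposition.mem_curve (hX : ∀ v : V, X v = 0 → v = 0)
    (h : IsSlopeDecomposition X (dualNorm X) c d) {a : V}
    (ha : ⟪a, c - a⟫_ℝ = X a * dualNorm X (c - a)) :
    (X a, dualNorm X (c - a)) ∈
      polygonalCurve (breakpoint (fun i => X (d i)) fun i => dualNorm X (d i)) := by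
  obtain ⟨p, hp, hp1⟩ := h.exists_mem_fst_eq hX (apply_nonneg X a)
    ((isDecomposition_of_inner_eq hX (add_sub_cancel a c).symm ha).2.fst_le (by simp))
  obtain ⟨a', ha', h1, h2, -⟩ := h.exists_of_mem hX hp
  obtain rfl : a = a' := eq_of_inner_eq hX ha ha' (by simp) (by rw [h1, hp1])
  rwa [h1, h2]

theorem IsSlopeDecomposition.isTight (hX : ∀ v : V, X v = 0 → v = 0)
    (h : IsSlopeDecomposition X (dualNorm X) c d) : IsTight X (dualNorm X) c := by
  rw [isTight_iff_forall hX]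
  intro a ha
  obtain ⟨-, -, -, -, h'⟩ := h.exists_of_mem hX (h.mem_curve hX ha)
  exact h'

theorem IsSlopeDecomposition.paretoSubFrontier_eq_curve (hX : ∀ v : V, X v = 0 → v = 0)
    (h : IsSlopeDecomposition X (dualNorm X) c d) :
    paretoSubFrontier X (dualNorm X) c =
      polygonalCurve (breakpoint (fun i => X (d i)) fun i => dualNorm X (d i)) := by
  rw [paretoSubFrontier_eq hX]
  ext p
  constructor
  · rintro ⟨a, ha, h1, h2⟩
    have := h.mem_curve hX ha
    rwa [h1, h2] at this
  · intro hp
    obtain ⟨a, ha, h1, h2, -⟩ := h.exists_of_mem hX hp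
    exact ⟨a, ha, h1, h2⟩

end

/-! ### The path of euclidean decompositions of a tight vector -/

/-- The vectors `α x`, for `x` between `0` and `‖c‖_X`, are the first parts of the euclidean
decompositions of `c`, parametrised by `x = ‖α x‖_X`, and `w x` is a dual certificate that
`(x, ‖c - α x‖_Y)` is efficient. -/
structure IsCertifiedPath (X : Seminorm ℝ V) (c : V) (α w : ℝ → V) : Prop where
  seminorm_eq : ∀ x ∈ Icc 0 (X c), X (α x) = x
  inner_eq : ∀ x ∈ Icc 0 (X c), ⟪α x, c - α x⟫_ℝ = x * dualNorm X (c - α x)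
  certificate_le : ∀ x ∈ Icc 0 (X c), X (w x) ≤ 1
  certificate_inner_right : ∀ x ∈ Icc 0 (X c), ⟪w x, c - α x⟫_ℝ = dualNorm X (c - α x)
  inner_certificate : ∀ x ∈ Icc 0 (X c), ⟪α x, w x⟫_ℝ = x * dualNorm X (w x)

theorem IsTight.exists_isCertifiedPath (hX : ∀ v : V, X v = 0 → v = 0)
    (h : IsTight X (dualNorm X) c) : ∃ α w, IsCertifiedPath X c α w := by
  rw [isTight_iff_forall hX] at h
  have : ∀ x, ∃ a w, x ∈ Icc 0 (X c) → X a = x ∧ ⟪a, c - a⟫_ℝ = x * dualNorm X (c - a) ∧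
      X w ≤ 1 ∧ ⟪w, c - a⟫_ℝ = dualNorm X (c - a) ∧ ⟪a, w⟫_ℝ = x * dualNorm X w := by
    intro x
    by_cases hx : x ∈ Icc 0 (X c)
    · obtain ⟨a, ha, hi⟩ := exists_inner_eq_of_le hX hx.1 hx.2
      obtain ⟨w, hw⟩ := exists_certificate hX (a := a) (b := c - a)
        (by rw [add_sub_cancel]; exact h a (by rw [ha, hi]))
      rw [ha] at hw
      exact ⟨a, w, fun _ => ⟨ha, hi, hw⟩⟩
    · exact ⟨0, 0, fun hx' => absurd hx' hx⟩
  choose α w h using this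
  exact ⟨α, w, fun x hx => (h x hx).1, fun x hx => (h x hx).2.1, fun x hx => (h x hx).2.2.1,
    fun x hx => (h x hx).2.2.2.1, fun x hx => (h x hx).2.2.2.2⟩

namespace IsCertifiedPath

variable {α w : ℝ → V}

/-- The dual norm of the certificate is minus the slope of a supporting line of the efficient
frontier. -/
theorem dualNorm_le_add_mul (hX : ∀ v : V, X v = 0 → v = 0) (h : IsCertifiedPath X c α w)
    {x y : ℝ} (hx : x ∈ Icc 0 (X c)) (hy : y ∈ Icc 0 (X c)) :
    dualNorm X (c - α x) ≤ dualNorm X (c - α y) + dualNorm X (w x) * (y - x) := by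
  have h1 := inner_le_mul_dualNorm hX (w x) (c - α y)
  have h2 := inner_le_mul_dualNorm hX (α y) (w x)
  have h3 := h.certificate_inner_right x hx
  have h4 := h.inner_certificate x hx
  rw [h.seminorm_eq y hy] at h2
  rw [inner_sub_right, real_inner_comm] at h1 h3
  rw [real_inner_comm] at h2 h4
  have h5 := mul_le_mul_of_nonneg_right (h.certificate_le x hx) (dualNorm_nonneg hX (c - α y))
  linarith

theorem dualNorm_certificate_anti (hX : ∀ v : V, X v = 0 → v = 0) (h : IsCertifiedPath X c α w)
    {x y : ℝ} (hx : x ∈ Icc 0 (X c)) (hy : y ∈ Icc 0 (X c)) (hxy : x < y) :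
    dualNorm X (w y) ≤ dualNorm X (w x) := by
  have h1 := h.dualNorm_le_add_mul hX hx hy
  have h2 := h.dualNorm_le_add_mul hX hy hx
  nlinarith

theorem dualNorm_anti (hX : ∀ v : V, X v = 0 → v = 0) (h : IsCertifiedPath X c α w)
    {x y : ℝ} (hx : x ∈ Icc 0 (X c)) (hy : y ∈ Icc 0 (X c)) (hxy : x ≤ y) :
    dualNorm X (c - α y) ≤ dualNorm X (c - α x) := by
  have h2 := h.dualNorm_le_add_mul hX hy hx
  nlinarith [dualNorm_nonneg hX (w y)]

/-- The certificate is close to the difference quotient of the path. -/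
theorem norm_sub_smul_sq_le (hX : ∀ v : V, X v = 0 → v = 0) (h : IsCertifiedPath X c α w)
    {x y : ℝ} (hx : x ∈ Icc 0 (X c)) (hy : y ∈ Icc 0 (X c)) (hxy : x ≤ y) :
    ‖α y - α x - (y - x) • w x‖ ^ 2 ≤
      (y - x) ^ 2 * (dualNorm X (w x) - dualNorm X (w y)) := by
  have ht : 0 ≤ y - x := sub_nonneg.2 hxy
  have h1 : ⟪w x, c - α y⟫_ℝ ≤ dualNorm X (c - α y) :=
    (inner_le_mul_dualNorm hX _ _).trans
      (mul_le_of_le_one_left (dualNorm_nonneg hX _) (h.certificate_le x hx))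
  have h2 : ⟪w x, w x⟫_ℝ ≤ dualNorm X (w x) :=
    (inner_le_mul_dualNorm hX _ _).trans
      (mul_le_of_le_one_left (dualNorm_nonneg hX _) (h.certificate_le x hx))
  have h3 := inner_le_mul_dualNorm hX (α y) (c - α x)
  have h4 := inner_le_mul_dualNorm hX (α x) (c - α y)
  have h5 := h.inner_eq x hx
  have h6 := h.inner_eq y hy
  have h7 := h.certificate_inner_right x hx
  rw [h.seminorm_eq x hx] at h4
  rw [h.seminorm_eq y hy] at h3
  have e1 : ⟪α y - α x, α y - α x⟫_ℝ = ⟪α y, c - α x⟫_ℝ - ⟪α x, c - α x⟫_ℝ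
      - ⟪α y, c - α y⟫_ℝ + ⟪α x, c - α y⟫_ℝ := by
    simp only [inner_sub_left, inner_sub_right]
    ring
  have e2 : ⟪α y - α x, w x⟫_ℝ = ⟪w x, c - α x⟫_ℝ - ⟪w x, c - α y⟫_ℝ := by
    rw [real_inner_comm]
    simp only [inner_sub_right]
    ring
  have e3 := mul_le_mul_of_nonneg_left (h.dualNorm_le_add_mul hX hy hx) ht
  have e4 := mul_le_mul_of_nonneg_left h2 (sq_nonneg (y - x))
  have e5 := mul_le_mul_of_nonneg_left h1 ht
  rw [← real_inner_self_eq_norm_sq, inner_sub_sub_self, inner_smul_left, inner_smul_right,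
    inner_smul_left, inner_smul_right, RCLike.conj_to_real, real_inner_comm (α y - α x) (w x), e2,
    e1]
  nlinarith

end IsCertifiedPath

/-- A function `p` of intervals that is subadditive and bounded by the length times
`ε + K ε * (m x - m y)`, for every `ε > 0`, is nonpositive: bisection halves the second term. -/
theorem nonpos_of_subadditive {p : ℝ → ℝ → ℝ} {m K : ℝ → ℝ} {a b : ℝ}
    (hsub : ∀ x y z, a ≤ x → x ≤ y → y ≤ z → z ≤ b → p x z ≤ p x y + p y z)
    (hp : ∀ ε > 0, ∀ x y, a ≤ x → x ≤ y → y ≤ b → p x y ≤ (y - x) * (ε + K ε * (m x - m y)))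
    {x y : ℝ} (hx : a ≤ x) (hxy : x ≤ y) (hy : y ≤ b) : p x y ≤ 0 := by
  have key : ∀ ε > 0, ∀ n : ℕ, ∀ x y, a ≤ x → x ≤ y → y ≤ b →
      p x y ≤ (y - x) * (ε + K ε * (m x - m y) / 2 ^ n) := by
    intro ε hε n
    induction n with
    | zero => simpa using hp ε hε
    | succ n ih =>
      intro x y hx hxy hy
      have h1 := ih x ((x + y) / 2) hx (by linarith) (by linarith)
      have h2 := ih ((x + y) / 2) y (by linarith) (by linarith) hy
      have h3 := hsub x ((x + y) / 2) y hx (by linarith) (by linarith) hy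
      refine (h3.trans (add_le_add h1 h2)).trans (le_of_eq ?_)
      rw [pow_succ]
      field_simp
      ring
  have lim : ∀ ε > 0, p x y ≤ (y - x) * ε := by
    intro ε hε
    have h0 : Filter.Tendsto (fun n : ℕ => K ε * (m x - m y) / 2 ^ n) Filter.atTop (nhds 0) :=
      tendsto_const_nhds.div_atTop (tendsto_pow_atTop_atTop_of_one_lt one_lt_two)
    have h1 := (h0.const_add ε).const_mul (y - x)
    rw [add_zero] at h1
    exact ge_of_tendsto' h1 fun n => key ε hε n x y hx hxy hy
  rcases hxy.eq_or_lt with rfl | hlt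
  · simpa using lim 1 one_pos
  · refine le_of_forall_pos_le_add fun ε hε => ?_
    have := lim (ε / (y - x)) (div_pos hε (sub_pos.2 hlt))
    rwa [mul_div_cancel₀ _ (sub_pos.2 hlt).ne', ← zero_add ε] at this

namespace IsCertifiedPath

variable {α w : ℝ → V}

theorem norm_sub_smul_le (hX : ∀ v : V, X v = 0 → v = 0) (h : IsCertifiedPath X c α w)
    {x y ε : ℝ} (hx : x ∈ Icc 0 (X c)) (hy : y ∈ Icc 0 (X c)) (hxy : x ≤ y) (hε : 0 < ε) :
    ‖α y - α x - (y - x) • w x‖ ≤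
      (y - x) * (ε + (dualNorm X (w x) - dualNorm X (w y)) / ε) := by
  have ht : 0 ≤ y - x := sub_nonneg.2 hxy
  rcases hxy.eq_or_lt with rfl | hlt
  · simp
  have hm := sub_nonneg.2 (h.dualNorm_certificate_anti hX hx hy hlt)
  set δ := dualNorm X (w x) - dualNorm X (w y) with hδ
  refine abs_le_of_sq_le_sq' ?_ (by positivity) |>.2
  refine (h.norm_sub_smul_sq_le hX hx hy hxy).trans ?_
  rw [mul_pow]
  refine mul_le_mul_of_nonneg_left ?_ (sq_nonneg _)
  have : (ε + δ / ε) ^ 2 = ε ^ 2 + 2 * δ + (δ / ε) ^ 2 := by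
    field_simp
    ring
  rw [← hδ, this]
  nlinarith [sq_nonneg ε, sq_nonneg (δ / ε)]

/-- Along the path of a tight vector, the `X`-norm is additive. -/
theorem seminorm_sub_eq (hX : ∀ v : V, X v = 0 → v = 0) (h : IsCertifiedPath X c α w)
    {x y : ℝ} (hx : 0 ≤ x) (hxy : x ≤ y) (hy : y ≤ X c) : X (α y - α x) = y - x := by
  obtain ⟨C, hC, hC1, -⟩ := exists_bounds hX
  apply le_antisymm
  · rw [← sub_nonpos]
    refine nonpos_of_subadditive (p := fun x y => X (α y - α x) - (y - x))
      (m := fun x => dualNorm X (w x)) (K := fun ε => C ^ 2 / ε) (a := 0) (b := X c)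
      (fun x y z _ _ _ _ => ?_) (fun ε hε x y hx hxy hy => ?_) hx hxy hy
    · have := map_add_le_add X (α y - α x) (α z - α y)
      rw [sub_add_sub_cancel'] at this
      linarith
    · have hx' : x ∈ Icc 0 (X c) := ⟨hx, hxy.trans hy⟩
      have h1 := h.norm_sub_smul_le hX hx' ⟨hx.trans hxy, hy⟩ hxy (div_pos hε hC)
      have h2 := map_add_le_add X (α y - α x - (y - x) • w x) ((y - x) • w x)
      rw [sub_add_cancel, seminorm_smul_of_nonneg X (sub_nonneg.2 hxy)] at h2
      have h3 := mul_le_mul_of_nonneg_left (h.certificate_le x hx') (sub_nonneg.2 hxy)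
      have h4 := (hC1 _).trans (mul_le_mul_of_nonneg_left h1 hC.le)
      refine (by linarith : _ ≤ _).trans (h4.trans (le_of_eq ?_))
      field_simp
  · have := map_add_le_add X (α y - α x) (α x)
    rw [sub_add_cancel, h.seminorm_eq x ⟨hx, hxy.trans hy⟩,
      h.seminorm_eq y ⟨hx.trans hxy, hy⟩] at this
    linarith

/-- Along the path of a tight vector, the dual norm is additive. -/
theorem dualNorm_sub_eq (hX : ∀ v : V, X v = 0 → v = 0) (h : IsCertifiedPath X c α w)
    {x y : ℝ} (hx : 0 ≤ x) (hxy : x ≤ y) (hy : y ≤ X c) :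
    dualNorm X (α y - α x) = dualNorm X (c - α x) - dualNorm X (c - α y) := by
  obtain ⟨C, hC, -, hC1⟩ := exists_bounds hX
  apply le_antisymm
  · rw [← sub_nonpos]
    refine nonpos_of_subadditive (p := fun x y => dualNorm X (α y - α x) -
        (dualNorm X (c - α x) - dualNorm X (c - α y)))
      (m := fun x => dualNorm X (w x)) (K := fun ε => 1 + C ^ 2 / ε) (a := 0) (b := X c)
      (fun x y z _ _ _ _ => ?_) (fun ε hε x y hx hxy hy => ?_) hx hxy hy
    · have := dualNorm_add_le hX (α y - α x) (α z - α y)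
      rw [sub_add_sub_cancel'] at this
      linarith
    · have hx' : x ∈ Icc 0 (X c) := ⟨hx, hxy.trans hy⟩
      have hy' : y ∈ Icc 0 (X c) := ⟨hx.trans hxy, hy⟩
      have h1 := h.norm_sub_smul_le hX hx' hy' hxy (div_pos hε hC)
      have h2 := dualNorm_add_le hX (α y - α x - (y - x) • w x) ((y - x) • w x)
      rw [sub_add_cancel] at h2
      have h3 := dualNorm_smul_le hX (sub_nonneg.2 hxy) (w x)
      have h4 := (hC1 _).trans (mul_le_mul_of_nonneg_left h1 hC.le)
      have h5 := h.dualNorm_le_add_mul hX hy' hx'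
      have h6 : C * ((y - x) * (ε / C + (dualNorm X (w x) - dualNorm X (w y)) / (ε / C))) =
          (y - x) * (ε + C ^ 2 / ε * (dualNorm X (w x) - dualNorm X (w y))) := by
        field_simp
      rw [h6] at h4
      linarith
  · have := dualNorm_add_le hX (α y - α x) (c - α y)
    rw [sub_add_sub_cancel'] at this
    linarith

theorem path_last (hX : ∀ v : V, X v = 0 → v = 0) (h : IsCertifiedPath X c α w) :
    α (X c) = c := by
  have hc : X c ∈ Icc 0 (X c) := ⟨apply_nonneg X c, le_rfl⟩
  refine eq_of_inner_eq hX (b := c - α (X c)) (b' := 0) ?_ (by simp [dualNorm_zero]) (by simp)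
    (h.seminorm_eq _ hc)
  rw [h.inner_eq _ hc, h.seminorm_eq _ hc]

theorem inner_sub_certificate (hX : ∀ v : V, X v = 0 → v = 0) (h : IsCertifiedPath X c α w)
    {x y z : ℝ} (hx : 0 ≤ x) (hxy : x ≤ y) (hyz : y ≤ z) (hz : z ≤ X c) :
    ⟪α y - α x, w z⟫_ℝ = (y - x) * dualNorm X (w z) := by
  have h1 := inner_le_mul_dualNorm hX (α y - α x) (w z)
  have h2 := inner_le_mul_dualNorm hX (α z - α y) (w z)
  have h3 := inner_le_mul_dualNorm hX (α x) (w z)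
  have h4 := h.inner_certificate z ⟨by linarith, hz⟩
  rw [h.seminorm_sub_eq hX hx hxy (hyz.trans hz)] at h1
  rw [h.seminorm_sub_eq hX (hx.trans hxy) hyz hz] at h2
  rw [h.seminorm_eq x ⟨hx, by linarith⟩] at h3
  simp only [inner_sub_left] at h1 h2 ⊢
  linarith

theorem certificate_inner_sub (hX : ∀ v : V, X v = 0 → v = 0) (h : IsCertifiedPath X c α w)
    {x y z : ℝ} (hx : 0 ≤ x) (hxy : x ≤ y) (hyz : y ≤ z) (hz : z ≤ X c) :
    ⟪w x, α z - α y⟫_ℝ = dualNorm X (c - α y) - dualNorm X (c - α z) := by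
  have hx' : x ∈ Icc 0 (X c) := ⟨hx, by linarith⟩
  have h0 : ∀ v, ⟪w x, v⟫_ℝ ≤ dualNorm X v := fun v => (inner_le_mul_dualNorm hX _ _).trans
      (mul_le_of_le_one_left (dualNorm_nonneg hX _) (h.certificate_le x hx'))
  have h1 := h0 (α z - α y)
  have h2 := h0 (α y - α x)
  have h3 := h0 (c - α z)
  have h4 := h.certificate_inner_right x hx'
  rw [h.dualNorm_sub_eq hX (hx.trans hxy) hyz hz] at h1
  rw [h.dualNorm_sub_eq hX hx hxy (hyz.trans hz)] at h2
  simp only [inner_sub_right] at h1 h2 h3 h4 ⊢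
  linarith

/-- Increments of the path over consecutive intervals satisfy the relation required of the
summands of a slope decomposition. -/
theorem inner_sub_sub (hX : ∀ v : V, X v = 0 → v = 0) (h : IsCertifiedPath X c α w)
    {x y z u : ℝ} (hx : 0 ≤ x) (hxy : x ≤ y) (hyz : y ≤ z) (hzu : z ≤ u) (hu : u ≤ X c) :
    ⟪α y - α x, α u - α z⟫_ℝ = X (α y - α x) * dualNorm X (α u - α z) := by
  have hz' : z ∈ Icc 0 (X c) := ⟨by linarith, by linarith⟩
  have h1 := inner_le_mul_dualNorm hX (α y - α x) (α u - α z)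
  have h2 := inner_le_mul_dualNorm hX (α z - α y) (α u - α z)
  have h3 := inner_le_mul_dualNorm hX (α x) (α u - α z)
  have h4 := h.inner_eq z hz'
  have h5 := inner_le_mul_dualNorm hX (α z) (c - α u)
  rw [h.seminorm_sub_eq hX hx hxy (by linarith), h.dualNorm_sub_eq hX hz'.1 hzu hu] at h1 ⊢
  rw [h.seminorm_sub_eq hX (hx.trans hxy) hyz (by linarith),
    h.dualNorm_sub_eq hX hz'.1 hzu hu] at h2
  rw [h.seminorm_eq x ⟨hx, by linarith⟩, h.dualNorm_sub_eq hX hz'.1 hzu hu] at h3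
  rw [h.seminorm_eq z hz'] at h5
  simp only [inner_sub_left, inner_sub_right] at h1 h2 h3 h4 h5 ⊢
  linarith

/-- On an interval on which the frontier is a segment, the increment of the path pairs with
itself as a summand of a slope decomposition. -/
theorem inner_sub_self (hX : ∀ v : V, X v = 0 → v = 0) (h : IsCertifiedPath X c α w)
    {x s z : ℝ} (hx : 0 ≤ x) (hxs : x ≤ s) (hsz : s ≤ z) (hz : z ≤ X c)
    (h1 : dualNorm X (c - α x) - dualNorm X (c - α s) = dualNorm X (w s) * (s - x))
    (h2 : dualNorm X (c - α s) - dualNorm X (c - α z) = dualNorm X (w s) * (z - s)) :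
    ⟪α z - α x, α z - α x⟫_ℝ = X (α z - α x) * dualNorm X (α z - α x) := by
  refine le_antisymm (inner_le_mul_dualNorm hX _ _) ?_
  have hs : s ∈ Icc 0 (X c) := ⟨by linarith, by linarith⟩
  rw [h.seminorm_sub_eq hX hx (hxs.trans hsz) hz, h.dualNorm_sub_eq hX hx (hxs.trans hsz) hz]
  have e1 := h.inner_sub_certificate hX hx hxs le_rfl hs.2
  have e2 := h.certificate_inner_sub hX hs.1 le_rfl hsz hz
  have e3 : ⟪w s, w s⟫_ℝ ≤ dualNorm X (w s) := (inner_le_mul_dualNorm hX _ _).trans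
      (mul_le_of_le_one_left (dualNorm_nonneg hX _) (h.certificate_le s hs))
  have e4 : ⟪α z - α x, w s⟫_ℝ = (z - x) * dualNorm X (w s) := by
    rw [real_inner_comm] at e2
    rw [← sub_add_sub_cancel (α z) (α s) (α x), inner_add_left, e1, e2, h2]
    ring
  have e5 : 0 ≤ ⟪α z - α x - (z - x) • w s, α z - α x - (z - x) • w s⟫_ℝ :=
    real_inner_self_nonneg
  rw [inner_sub_sub_self, inner_smul_left, inner_smul_right, inner_smul_left, inner_smul_right,
    RCLike.conj_to_real, real_inner_comm (α z - α x) (w s), e4] at e5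
  have e6 := mul_le_mul_of_nonneg_left e3 (sq_nonneg (z - x))
  have e7 : dualNorm X (c - α x) - dualNorm X (c - α z) = dualNorm X (w s) * (z - x) := by
    linarith
  rw [e7]
  nlinarith

end IsCertifiedPath

/-! ### Finiteness of the number of segments -/

namespace IsCertifiedPath

variable {α w : ℝ → V}

theorem inner_certificate_eq_zero (hX : ∀ v : V, X v = 0 → v = 0) (h : IsCertifiedPath X c α w)
    {z : ℝ} (hz : z ≤ X c) {v : V} (hv : v ∈ turnSpan α z) : ⟪v, w z⟫_ℝ = 0 := by
  have key : ∀ s ∈ Icc 0 z, ⟪α s, w z⟫_ℝ = s * dualNorm X (w z) := by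
    intro s hs
    have h0 : α 0 = 0 := hX _ (h.seminorm_eq 0 ⟨le_rfl, apply_nonneg X c⟩)
    simpa [h0] using h.inner_sub_certificate hX le_rfl hs.1 hs.2 hz
  have : turnSpan α z ≤ (ℝ ∙ w z)ᗮ := by
    refine Submodule.span_le.2 ?_
    rintro _ ⟨s, hs, t, ht, rfl⟩
    rw [SetLike.mem_coe, Submodule.mem_orthogonal_singleton_iff_inner_left, inner_sub_left,
      inner_smul_left, inner_smul_left, key s hs, key t ht]
    simp only [RCLike.conj_to_real]
    ring
  exact Submodule.mem_orthogonal_singleton_iff_inner_left.1 (this hv)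

/-- Where the dimension of `turnSpan` does not grow, the frontier is a segment: otherwise the
certificate at `y`, which is orthogonal to `turnSpan α y`, detects a new vector. -/
theorem dualNorm_sub_eq_of_finrank_eq (hX : ∀ v : V, X v = 0 → v = 0)
    (h : IsCertifiedPath X c α w) {y z : ℝ} (hy : 0 < y) (hyz : y ≤ z) (hz : z ≤ X c)
    (hr : Module.finrank ℝ (turnSpan α y) = Module.finrank ℝ (turnSpan α z)) :
    dualNorm X (c - α y) - dualNorm X (c - α z) = dualNorm X (w y) * (z - y) := by
  have hG := Submodule.eq_of_le_of_finrank_eq (turnSpan_mono α hyz) hr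
  have hmem : y • α z - z • α y ∈ turnSpan α z :=
    Submodule.subset_span ⟨y, ⟨hy.le, hyz⟩, z, ⟨hy.le.trans hyz, le_rfl⟩, rfl⟩
  rw [← hG] at hmem
  have h1 := h.inner_certificate_eq_zero hX (hyz.trans hz) hmem
  have h2 := h.certificate_inner_sub hX hy.le le_rfl hyz hz
  have h3 := h.inner_certificate y ⟨hy.le, hyz.trans hz⟩
  rw [real_inner_comm, inner_sub_left] at h2
  rw [inner_sub_left, inner_smul_left, inner_smul_left, RCLike.conj_to_real,
    RCLike.conj_to_real] at h1
  refine mul_left_cancel₀ hy.ne' ?_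
  linear_combination h1 - y * h2 + (z - y) * h3

/-- If the dimension of `turnSpan` is constant on `(x, t]`, the frontier is a segment over
`[x, t]`, supported by the certificate at any interior point `s`. -/
theorem dualNorm_sub_eq_left (hX : ∀ v : V, X v = 0 → v = 0) (h : IsCertifiedPath X c α w)
    {x s t : ℝ} (hx : 0 ≤ x) (hxs : x < s) (hst : s < t) (ht : t ≤ X c)
    (hr : ∀ u ∈ Ioc x t, Module.finrank ℝ (turnSpan α u) = Module.finrank ℝ (turnSpan α t)) :
    dualNorm X (c - α x) - dualNorm X (c - α s) = dualNorm X (w s) * (s - x) := by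
  have hx' : x ∈ Icc 0 (X c) := ⟨hx, by linarith⟩
  have hs' : s ∈ Icc 0 (X c) := ⟨by linarith, by linarith⟩
  have h1 := h.dualNorm_le_add_mul hX hs' hx'
  refine le_antisymm (le_of_not_gt fun hlt => ?_) (by linarith)
  -- At points `u` slightly to the right of `x` the claim holds, and the defect at `x` is at
  -- most a multiple of `u - x`.
  have key : ∀ u ∈ Ioo x s, dualNorm X (c - α x) - dualNorm X (c - α s) -
      dualNorm X (w s) * (s - x) ≤ (dualNorm X (w x) - dualNorm X (w s)) * (u - x) := by
    intro u hu
    have hu0 : 0 < u := hx.trans_lt hu.1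
    have e1 := h.dualNorm_sub_eq_of_finrank_eq hX hu0 (hu.2.trans hst).le ht
      (hr u ⟨hu.1, (hu.2.trans hst).le⟩)
    have e2 := h.dualNorm_sub_eq_of_finrank_eq hX hu0 hu.2.le (hst.le.trans ht)
      ((hr u ⟨hu.1, (hu.2.trans hst).le⟩).trans (hr s ⟨hxs, hst.le⟩).symm)
    have e3 := h.dualNorm_sub_eq_of_finrank_eq hX (hx.trans_lt hxs) hst.le ht (hr s ⟨hxs, hst.le⟩)
    have e4 := h.dualNorm_le_add_mul hX hx' (y := u) ⟨hu0.le, by linarith [hu.2]⟩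
    have e5 : dualNorm X (w u) = dualNorm X (w s) :=
      mul_right_cancel₀ (sub_pos.2 hst).ne' (by linarith)
    rw [e5] at e2
    linarith
  set η := dualNorm X (c - α x) - dualNorm X (c - α s) - dualNorm X (w s) * (s - x) with hη
  have hη0 : 0 < η := by linarith
  set K := dualNorm X (w x) - dualNorm X (w s) with hK
  have hK0 : 0 < K := by
    have := key ((x + s) / 2) ⟨by linarith, by linarith⟩
    have h3 : 0 < (x + s) / 2 - x := by linarith
    exact pos_of_mul_pos_left (hη0.trans_le this) h3.le
  have h4 := key (x + min ((s - x) / 2) (η / (2 * K)))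
    ⟨by have : 0 < min ((s - x) / 2) (η / (2 * K)) := lt_min (by linarith) (by positivity)
        linarith, by linarith [min_le_left ((s - x) / 2) (η / (2 * K))]⟩
  have h5 := mul_le_mul_of_nonneg_left (min_le_right ((s - x) / 2) (η / (2 * K))) hK0.le
  have h6 : K * (η / (2 * K)) = η / 2 := by field_simp
  rw [add_sub_cancel_left] at h4
  linarith

/-- The maximal segment of the frontier with the direction of the supporting line at `s`. -/
theorem exists_maximal_segment (hX : ∀ v : V, X v = 0 → v = 0) (h : IsCertifiedPath X c α w)
    {s : ℝ} (hs : s ∈ Icc 0 (X c)) : ∃ z, s ≤ z ∧ z ≤ X c ∧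
      dualNorm X (c - α s) - dualNorm X (c - α z) = dualNorm X (w s) * (z - s) ∧
      ∀ t ∈ Icc s (X c),
        dualNorm X (c - α s) - dualNorm X (c - α t) = dualNorm X (w s) * (t - s) → t ≤ z := by
  set Z := {t | t ∈ Icc s (X c) ∧
    dualNorm X (c - α s) - dualNorm X (c - α t) = dualNorm X (w s) * (t - s)} with hZ
  have hsZ : s ∈ Z := ⟨⟨le_rfl, hs.2⟩, by simp⟩
  have hbdd : BddAbove Z := ⟨X c, fun t ht => ht.1.2⟩
  have hle : ∀ t ∈ Z, t ≤ sSup Z := fun t ht => le_csSup hbdd ht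
  have hz1 : s ≤ sSup Z := hle s hsZ
  have hz2 : sSup Z ≤ X c := csSup_le ⟨s, hsZ⟩ fun t ht => ht.1.2
  have hz' : sSup Z ∈ Icc 0 (X c) := ⟨hs.1.trans hz1, hz2⟩
  refine ⟨sSup Z, hz1, hz2, ?_, fun t ht h1 => hle t ⟨ht, h1⟩⟩
  have h1 := h.dualNorm_le_add_mul hX hs hz'
  refine le_antisymm (by linarith) ?_
  have h2 : ∀ t ∈ Z, dualNorm X (w s) * (t - s) ≤
      dualNorm X (c - α s) - dualNorm X (c - α (sSup Z)) := by
    intro t ht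
    have := h.dualNorm_anti hX ⟨hs.1.trans ht.1.1, ht.1.2⟩ hz' (hle t ht)
    linarith [ht.2]
  rcases (dualNorm_nonneg hX (w s)).eq_or_lt with h0 | h0
  · rw [← h0, zero_mul]
    linarith [h.dualNorm_anti hX hs hz' hz1]
  · rw [mul_comm, ← le_div_iff₀ h0, sub_le_iff_le_add]
    refine csSup_le ⟨s, hsZ⟩ fun t ht => ?_
    rw [← sub_le_iff_le_add, le_div_iff₀ h0, mul_comm]
    exact h2 t ht

end IsCertifiedPath

/-! ### From tight vectors to slope decompositions -/

namespace IsCertifiedPath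

variable {α w : ℝ → V}

/-- The part of `c` beyond `α x` has a slope decomposition whose summands are increments of the
path. The induction is on the number of values that the dimension of `turnSpan` can still take
to the right of `x`; each step splits off the maximal segment of the frontier starting at `x`. -/
theorem exists_slopeDecomposition (hX : ∀ v : V, X v = 0 → v = 0) (h : IsCertifiedPath X c α w)
    (n : ℕ) : ∀ x ∈ Icc 0 (X c),
      (∀ t ∈ Ioc x (X c), Module.finrank ℝ V + 1 ≤ Module.finrank ℝ (turnSpan α t) + n) →
      ∃ (r : ℕ) (d : Fin r → V), IsSlopeDecomposition X (dualNorm X) (c - α x) d ∧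
        ∀ i, ∃ u v, x ≤ u ∧ u < v ∧ v ≤ X c ∧ d i = α v - α u := by
  have hend : ∃ (r : ℕ) (d : Fin r → V), IsSlopeDecomposition X (dualNorm X) (c - α (X c)) d ∧
        ∀ i, ∃ u v, X c ≤ u ∧ u < v ∧ v ≤ X c ∧ d i = α v - α u := by
    refine ⟨0, Fin.elim0, ⟨by rw [h.path_last hX]; simp, fun i => i.elim0, fun i => i.elim0,
      fun i => i.elim0⟩, fun i => i.elim0⟩
  induction n with
  | zero =>
    intro x hx hn
    rcases hx.2.eq_or_lt with rfl | hlt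
    · exact hend
    · have := hn (X c) ⟨hlt, le_rfl⟩
      have := (turnSpan α (X c)).finrank_le
      omega
  | succ n ih =>
    intro x hx hn
    by_cases hcase : ∀ t ∈ Ioc x (X c),
        Module.finrank ℝ V + 1 ≤ Module.finrank ℝ (turnSpan α t) + n
    · exact ih x hx hcase
    push Not at hcase
    obtain ⟨t₀, ht₀, hlow⟩ := hcase
    have hmono : ∀ {u v : ℝ}, u ≤ v →
        Module.finrank ℝ (turnSpan α u) ≤ Module.finrank ℝ (turnSpan α v) := fun huv =>
      Submodule.finrank_mono (turnSpan_mono α huv)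
    have hconst : ∀ t ∈ Ioc x (X c), Module.finrank ℝ (turnSpan α t) + n < Module.finrank ℝ V + 1 →
        ∀ u ∈ Ioc x t, Module.finrank ℝ (turnSpan α u) = Module.finrank ℝ (turnSpan α t) := by
      intro t ht hlt u hu
      have h1 := hn u ⟨hu.1, hu.2.trans ht.2⟩
      have h2 := hmono hu.2
      omega
    obtain ⟨s, hxs, hst⟩ := exists_between ht₀.1
    have hs : s ∈ Icc 0 (X c) := ⟨hx.1.trans hxs.le, hst.le.trans ht₀.2⟩
    have hleft := h.dualNorm_sub_eq_left hX hx.1 hxs hst ht₀.2 (hconst t₀ ht₀ hlow)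
    obtain ⟨z, hsz, hz, hright, hmax⟩ := h.exists_maximal_segment hX hs
    have hxz : x < z := hxs.trans_le hsz
    have hz' : z ∈ Icc 0 (X c) := ⟨hx.1.trans hxz.le, hz⟩
    obtain ⟨r, d, hd, hform⟩ := ih z hz' fun t ht => by
      by_contra! hlt
      have h1 : s < t := hsz.trans_lt ht.1
      have h2 := h.dualNorm_sub_eq_of_finrank_eq hX (hx.1.trans_lt hxs) h1.le ht.2
        (hconst t ⟨hxs.trans h1, ht.2⟩ hlt s ⟨hxs, h1.le⟩)
      exact absurd (hmax t ⟨h1.le, ht.2⟩ h2) (not_le.2 ht.1)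
    have hXv := h.seminorm_sub_eq hX hx.1 hxz.le hz
    have hYv := h.dualNorm_sub_eq hX hx.1 hxz.le hz
    have hv : α z - α x ≠ 0 := by
      intro h0
      rw [h0, map_zero] at hXv
      linarith
    refine ⟨r + 1, Fin.cons (α z - α x) d, ?_, ?_⟩
    · rw [← sub_add_sub_cancel' (α z) (α x) c]
      refine hd.cons hv (h.inner_sub_self hX hx.1 hxs.le hsz hz hleft hright) (fun i => ?_)
        fun i => ?_
      · obtain ⟨u, v, hzu, huv, hv, hi⟩ := hform i
        rw [hi]
        exact h.inner_sub_sub hX hx.1 hxz.le hzu huv.le hv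
      · obtain ⟨u, v, hzu, huv, hv, hi⟩ := hform i
        have hu' : u ∈ Icc 0 (X c) := ⟨hz'.1.trans hzu, huv.le.trans hv⟩
        have hv' : v ∈ Icc 0 (X c) := ⟨hu'.1.trans huv.le, hv⟩
        rw [hi, slope, slope, hXv, hYv, h.seminorm_sub_eq hX hu'.1 huv.le hv,
          h.dualNorm_sub_eq hX hu'.1 huv.le hv]
        have e1 : dualNorm X (c - α x) - dualNorm X (c - α z) = dualNorm X (w s) * (z - x) := by
          linarith
        rw [e1, mul_div_cancel_right₀ _ (sub_pos.2 hxz).ne', div_lt_iff₀ (sub_pos.2 huv)]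
        -- Otherwise `v` would lie on the line of the maximal segment.
        by_contra! hcon
        have e2 := h.dualNorm_le_add_mul hX hu' hv'
        have e3 := h.dualNorm_le_add_mul hX hu' hz'
        have e4 := h.dualNorm_le_add_mul hX hs hv'
        have e5 : dualNorm X (w s) ≤ dualNorm X (w u) :=
          le_of_mul_le_mul_right (by linarith) (sub_pos.2 huv)
        have e6 := mul_le_mul_of_nonneg_right e5 (sub_nonneg.2 hzu)
        have e7 := hmax v ⟨hsz.trans (hzu.trans huv.le), hv⟩ (le_antisymm (by linarith)
          (by linarith))
        linarith
    · intro i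
      cases i using Fin.cases with
      | zero => exact ⟨x, z, le_rfl, hxz, hz, rfl⟩
      | succ i =>
        obtain ⟨u, v, hzu, huv, hv, hi⟩ := hform i
        exact ⟨u, v, hxz.le.trans hzu, huv, hv, hi⟩

end IsCertifiedPath

theorem IsTight.exists_slopeDecomposition (hX : ∀ v : V, X v = 0 → v = 0)
    (h : IsTight X (dualNorm X) c) :
    ∃ (r : ℕ) (d : Fin r → V), IsSlopeDecomposition X (dualNorm X) c d := by
  obtain ⟨α, w, h⟩ := h.exists_isCertifiedPath hX
  have h00 : (0 : ℝ) ∈ Icc 0 (X c) := ⟨le_rfl, apply_nonneg X c⟩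
  obtain ⟨r, d, hd, -⟩ := h.exists_slopeDecomposition hX (Module.finrank ℝ V + 1) 0 h00
    fun t _ => by omega
  rw [hX _ (h.seminorm_eq 0 h00), sub_zero] at hd
  exact ⟨r, d, hd⟩

end ParetoSlope

theorem theorem2p7 {V : Type*} [NormedAddCommGroup V] [InnerProductSpace ℝ V]
    [FiniteDimensional ℝ V] (X : Seminorm ℝ V) (hX : ∀ v : V, X v = 0 → v = 0) (c : V) :
    ((ParetoSlope.IsTight X (ParetoSlope.dualNorm X) c ↔
        ParetoSlope.paretoFrontier X (ParetoSlope.dualNorm X) c =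
          ParetoSlope.paretoSubFrontier X (ParetoSlope.dualNorm X) c) ∧
      (ParetoSlope.IsTight X (ParetoSlope.dualNorm X) c ↔
        ∃ (r : ℕ) (d : Fin r → V),
          ParetoSlope.IsSlopeDecomposition X (ParetoSlope.dualNorm X) c d)) ∧
    ∀ (r : ℕ) (d : Fin r → V),
      ParetoSlope.IsSlopeDecomposition X (ParetoSlope.dualNorm X) c d →
        X c = ∑ i, X (d i) ∧
        ParetoSlope.dualNorm X c = ∑ i, ParetoSlope.dualNorm X (d i) ∧
        ParetoSlope.paretoFrontier X (ParetoSlope.dualNorm X) c =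
          ParetoSlope.paretoSubFrontier X (ParetoSlope.dualNorm X) c ∧
        ParetoSlope.paretoFrontier X (ParetoSlope.dualNorm X) c =
          ParetoSlope.polygonalCurve
            (ParetoSlope.breakpoint (fun i => X (d i))
              (fun i => ParetoSlope.dualNorm X (d i))) := by
  refine ⟨⟨ParetoSlope.isTight_iff_frontier_eq hX, fun h => h.exists_slopeDecomposition hX,
    fun ⟨_, _, h⟩ => h.isTight hX⟩, fun r d h => ?_⟩
  have hfr := (ParetoSlope.isTight_iff_frontier_eq hX).1 (h.isTight hX)
  exact ⟨h.seminorm_eq hX, h.dualNorm_eq hX, hfr, hfr.trans (h.paretoSubFrontier_eq_curve hX)⟩
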